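/- A project requires an investment $I>0$; the risk-free rate is $r>0$. If the entrepreneur exerts effort $e\in[0,\bar e]$ ($\bar e>0$), at cost $C(e)\ge 0$ with $C$ differentiable on $[0,\bar e]$, the profit has a density $\phi(\cdot|e)$ on $[0,1]$, where $\phi(x|e)>0$ for all $x\in[0,1]$ and $e\in[0,\bar e]$, $\phi(x|\cdot)$ is differentiable on $[0,\bar e]$ for every $x\in[0,1]$, with derivative $\phi_e(x|e)$, and there is an integrable $g$ on $[0,1]$ with $|\phi_e(x|e)|\le g(x)$ for all $x$ and $e$. (Derivatives at the end points of $[0,\bar e]$ are one-sided.) Let $\mathcal I$ be the set of securities: nondecreasing, right-continuous functions $H:[0,1]\to\mathbb R$ with $0\le H(x)\le x$ for all $x$. The entrepreneur's problem is to maximize $$\int_0^1 (x-H(x))\,\phi(x|e)\,dx-C(e)$$ over $H\in\mathcal I$ and $e\in[0,\bar e]$ subject to $$\int_0^1 (x-H(x))\,\phi_e(x|e)\,dx=C'(e)\quad\text{(FOC)}\qquad\text{and}\qquad \int_0^1 H(x)\,\phi(x|e)\,dx\ge(1+r)I .$$ Assume that the first-order approach is valid, i.e. for every $H\in\mathcal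 I$, every $e\in[0,\bar e]$ that satisfies (FOC) maximizes $\int_0^1 (x-H(x))\,\phi(x|e')\,dx-C(e')$ over $e'\in[0,\bar e]$; and assume that some pair $(H,e)$ satisfies all the constraints. No monotone likelihood ratio property is assumed. A security $H\in\mathcal I$ is a contingent debt contract if there is a countable (possibly finite or empty) collection of intervals $[\underline x_n,\overline x_n)$, with $0\le\underline x_n<1$, $\underline x_n<\overline x_n$, understood as subsets of $[0,1]$ (where $\overline x_n>1$ is allowed, so that an interval may contain $1$), such that $H$ is constant on each of them, $H(x)=x$ for all $x\in[0,1]$ outside their union, and $H(\underline x_n)\ne H(\underline x_m)$ for $n\neq m$. Its face values are $d_n=H(\underline x_n)$; $d_n$ is non-defaultable if $d_n<x$ for all $x\in[\underline x_n,\overline x_n)\cap[0,1]$. Then there are a contingent debt contract $H$ with at most two non-defaultable face values and an effort $e\in[0,\bar e]$ such that $(H,e)$ solves the entrepreneur's problem. -/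

import Mathlib

open Set MeasureTheory

/-- The interval of monotone functions on `[0, 1]` between `F` and `G`: the nondecreasing,
right-continuous functions `H` on `[0, 1]` with `F ≤ H ≤ G` there.  A function on `[0, 1]` is
represented by a function on `ℝ`, whose values outside `[0, 1]` play no role. -/
def monotoneInterval (F G : ℝ → ℝ) : Set (ℝ → ℝ) :=
  {H | MonotoneOn H (Icc 0 1) ∧
    (∀ x ∈ Ico (0 : ℝ) 1, ContinuousWithinAt H (Ici x) x) ∧
    ∀ x ∈ Icc (0 : ℝ) 1, F x ≤ H x ∧ H x ≤ G x}

/-- Securities: nondecreasing, right-continuous, with limited liability `0 ≤ H x ≤ x`. -/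
def securities : Set (ℝ → ℝ) := monotoneInterval (fun _ => 0) (fun x => x)

/-- The primitives of the security design problem under moral hazard: the effort levels are
`e ∈ [0, ebar]`, the cost of effort `e` is `C e`, the profit given effort `e` has density `φ e`
on `[0, 1]`, the project needs the investment `inv`, and `r` is the risk-free rate of return.
All derivatives in effort are derivatives on `[0, ebar]` (one-sided at the end points). -/
structure MoralHazard where
  ebar : ℝ
  ebar_pos : 0 < ebar
  inv : ℝ
  inv_pos : 0 < inv
  r : ℝ
  r_pos : 0 < r
  C : ℝ → ℝ
  C_nonneg : ∀ e ∈ Icc 0 ebar, 0 ≤ C e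
  C_differentiable : DifferentiableOn ℝ C (Icc 0 ebar)
  φ : ℝ → ℝ → ℝ
  φ_integrable : ∀ e ∈ Icc 0 ebar, IntegrableOn (φ e) (Icc 0 1)
  φ_integral : ∀ e ∈ Icc 0 ebar, ∫ x in (0 : ℝ)..1, φ e x = 1
  φ_pos : ∀ e ∈ Icc 0 ebar, ∀ x ∈ Icc (0 : ℝ) 1, 0 < φ e x
  φ_differentiable : ∀ x ∈ Icc (0 : ℝ) 1, DifferentiableOn ℝ (fun e => φ e x) (Icc 0 ebar)
  φ_dominated : ∃ g : ℝ → ℝ, IntegrableOn g (Icc 0 1) ∧ ∀ e ∈ Icc 0 ebar,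
    ∀ x ∈ Icc (0 : ℝ) 1, |derivWithin (fun t => φ t x) (Icc 0 ebar) e| ≤ g x

namespace MoralHazard

variable (M : MoralHazard)

/-- The derivative `φ_e(x | e)` of the density in effort. -/
noncomputable def φe (e x : ℝ) : ℝ := derivWithin (fun t => M.φ t x) (Icc 0 M.ebar) e

/-- The marginal cost of effort `C'(e)`. -/
noncomputable def C' (e : ℝ) : ℝ := derivWithin M.C (Icc 0 M.ebar) e

/-- The entrepreneur's expected payoff from security `H` and effort `e`. -/
noncomputable def payoff (H : ℝ → ℝ) (e : ℝ) : ℝ :=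
  (∫ x in (0 : ℝ)..1, (x - H x) * M.φ e x) - M.C e

/-- Given the security `H`, the effort level `e` solves the entrepreneur's effort problem. -/
def SolvesEffort (H : ℝ → ℝ) (e : ℝ) : Prop :=
  e ∈ Icc 0 M.ebar ∧ ∀ e' ∈ Icc 0 M.ebar, M.payoff H e' ≤ M.payoff H e

/-- The first-order condition of the effort problem. -/
def FOC (H : ℝ → ℝ) (e : ℝ) : Prop :=
  ∫ x in (0 : ℝ)..1, (x - H x) * M.φe e x = M.C' e

/-- The constraints of the entrepreneur's problem. -/
def Feasible (H : ℝ → ℝ) (e : ℝ) : Prop :=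
  H ∈ securities ∧ e ∈ Icc 0 M.ebar ∧ M.FOC H e ∧
    (1 + M.r) * M.inv ≤ ∫ x in (0 : ℝ)..1, H x * M.φ e x

/-- `(H, e)` solves the entrepreneur's problem: it is feasible and attains the maximal payoff. -/
def Solves (H : ℝ → ℝ) (e : ℝ) : Prop :=
  M.Feasible H e ∧ ∀ H' e', M.Feasible H' e' → M.payoff H' e' ≤ M.payoff H e

end MoralHazard

/-- `H` is a contingent debt contract with the intervals `[a n, b n)`, understood as subsets of
`[0, 1]`: `b n > 1` is allowed, so that an interval may contain the highest profit `1` (as it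
must for a standard debt contract). -/
structure IsContingentDebtOn {ι : Type} (H : ℝ → ℝ) (a b : ι → ℝ) : Prop where
  security : H ∈ securities
  endpoints : ∀ n, 0 ≤ a n ∧ a n < 1 ∧ a n < b n
  constant : ∀ n, ∀ x ∈ Ico (a n) (b n) ∩ Icc 0 1, H x = H (a n)
  eq_self : ∀ x ∈ Icc (0 : ℝ) 1, (∀ n, x ∉ Ico (a n) (b n)) → H x = x
  distinct : ∀ n m, n ≠ m → H (a n) ≠ H (a m)

/-- The non-defaultable face values: those `H (a n)` that are below every profit in the
interval `[a n, b n)` in which they are in effect. -/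
def nonDefaultable {ι : Type} (H : ℝ → ℝ) (a b : ι → ℝ) : Set ℝ :=
  {d | ∃ n, d = H (a n) ∧ ∀ x ∈ Ico (a n) (b n) ∩ Icc 0 1, d < x}

/-- `H` is a contingent debt contract with countably many face values, at most `k` of which
are non-defaultable. -/
def IsContingentDebt (H : ℝ → ℝ) (k : ℕ) : Prop :=
  ∃ (ι : Type) (a b : ι → ℝ), Countable ι ∧ IsContingentDebtOn H a b ∧
    (nonDefaultable H a b).encard ≤ k

/-! Among the securities with the same integrals against `k` given weights as a given security, one
maximises `∫ H²`. If `k + 1` values `v` of this maximiser `H` had `H v < v`, small tents around them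
would have a nonzero linear combination `η` for which `η ∘ H` has zero integral against all weights.
Since `H v < v < 1`, the function `H` stays away both from `0` and from the diagonal where it is
near `v`, so `H ± η ∘ H` would be securities as well, and strict convexity contradicts maximality. A
security with finitely many such values is, off the diagonal, constant on each of countably many
intervals.

For a solution `(H, e)` of the entrepreneur's problem, the weights `φ(· | e)` and `φ_e(· | e)`
determine the payoff and both constraints. A solution exists by Helly's selection theorem. The
first-order condition survives the limit because, under the first-order approach, the payoff has no
critical point other than global maxima, which makes the marginal payoff of each feasible security
nonnegative at `0` and nonpositive at `ē`. -/

open Filter Topology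

section Selection

theorem tendsto_of_monotone_of_dense {ι α β : Type*} [LinearOrder α] [TopologicalSpace α]
    [OrderTopology α] [DenselyOrdered α] [NoMinOrder α] [NoMaxOrder α] [LinearOrder β]
    [TopologicalSpace β] [OrderTopology β] {l : Filter ι} {u : ι → α → β} {L : α → β} {s : Set α}
    {x : α} (hs : Dense s) (hu : ∀ i, Monotone (u i))
    (hlim : ∀ q ∈ s, Tendsto (fun i => u i q) l (𝓝 (L q))) (hL : ContinuousAt L x) :
    Tendsto (fun i => u i x) l (𝓝 (L x)) := by
  refine tendsto_order.2 ⟨fun c hc => ?_, fun c hc => ?_⟩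
  · obtain ⟨y, hyx, hy⟩ := exists_Ioc_subset_of_mem_nhds (hL.eventually (lt_mem_nhds hc))
      (exists_lt x)
    obtain ⟨q, hq, hyq, hqx⟩ := hs.exists_between hyx
    filter_upwards [(hlim q hq).eventually (lt_mem_nhds (hy ⟨hyq, hqx.le⟩))] with i hi
      using hi.trans_le (hu i hqx.le)
  · obtain ⟨y, hxy, hy⟩ := exists_Ico_subset_of_mem_nhds (hL.eventually (gt_mem_nhds hc))
      (exists_gt x)
    obtain ⟨q, hq, hxq, hqy⟩ := hs.exists_between hxy
    filter_upwards [(hlim q hq).eventually (gt_mem_nhds (hy ⟨hxq.le, hqy⟩))] with i hi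
      using (hu i hxq.le).trans_lt hi

/-- Helly's selection theorem, with a right-continuous limit. -/
theorem exists_subseq_tendsto_stieltjesFunction {u : ℕ → ℝ → ℝ} {f : ℝ → ℝ}
    {g : StieltjesFunction ℝ} (hu : ∀ n, Monotone (u n))
    (hmem : ∀ n x, u n x ∈ Icc (f x) (g x)) :
    ∃ (F : StieltjesFunction ℝ) (ψ : ℕ → ℕ), StrictMono ψ ∧ (∀ x, F x ∈ Icc (f x) (g x)) ∧
      {x | ¬ Tendsto (fun n => u (ψ n) x) atTop (𝓝 (F x))}.Countable := by
  obtain ⟨ℓ, -, ψ, hψ, hℓ⟩ :=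
    (isCompact_univ_pi fun q : ℚ => isCompact_Icc (a := f q) (b := g q)).tendsto_subseq
      (x := fun n (q : ℚ) => u n q) fun n q _ => hmem n q
  have hge : ∀ x, IsBoundedUnder (· ≥ ·) atTop fun n => u (ψ n) x := fun x =>
    isBoundedUnder_of ⟨f x, fun n => (hmem (ψ n) x).1⟩
  have hle : ∀ x, IsBoundedUnder (· ≤ ·) atTop fun n => u (ψ n) x := fun x =>
    isBoundedUnder_of ⟨g x, fun n => (hmem (ψ n) x).2⟩
  set L : ℝ → ℝ := fun x => limsup (fun n => u (ψ n) x) atTop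
  have hL : Monotone L := fun x y hxy =>
    limsup_le_limsup (Eventually.of_forall fun n => hu (ψ n) hxy) (hge x).isCoboundedUnder_le
      (hle y)
  have hLrat : ∀ q ∈ range ((↑) : ℚ → ℝ), Tendsto (fun n => u (ψ n) q) atTop (𝓝 (L q)) := by
    rintro _ ⟨q, rfl⟩
    have hq : Tendsto (fun n => u (ψ n) q) atTop (𝓝 (ℓ q)) := tendsto_pi_nhds.1 hℓ q
    rwa [← hq.limsup_eq] at hq
  refine ⟨hL.stieltjesFunction, ψ, hψ, fun x => ⟨?_, ?_⟩, ?_⟩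
  · exact (le_limsup_of_frequently_le (Frequently.of_forall fun n => (hmem (ψ n) x).1)
      (hle x)).trans (hL.le_rightLim le_rfl)
  · refine ge_of_tendsto ((g.right_continuous x).mono Ioi_subset_Ici_self) ?_
    filter_upwards [self_mem_nhdsWithin] with y hy
    exact (hL.rightLim_le hy).trans (limsup_le_of_le (hge y).isCoboundedUnder_le
      (Eventually.of_forall fun n => (hmem (ψ n) y).2))
  · refine hL.countable_not_continuousAt.mono fun x (hx : ¬ _) => mt (fun hcont => ?_) hx
    rw [hL.stieltjesFunction_eq, hcont.continuousWithinAt.rightLim_eq]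
    exact tendsto_of_monotone_of_dense Rat.denseRange_cast (fun n => hu (ψ n)) hLrat hcont

variable {F G H : ℝ → ℝ}

theorem continuousWithinAt_IccExtend_Ici
    (hG : ∀ x ∈ Ico (0 : ℝ) 1, ContinuousWithinAt G (Ici x) x) (x : ℝ) :
    ContinuousWithinAt (IccExtend zero_le_one ((Icc 0 1).domRestrict G)) (Ici x) x := by
  obtain ⟨p, hp⟩ : ∃ p, projIcc (0 : ℝ) 1 zero_le_one x = p := ⟨_, rfl⟩
  have hGp : ContinuousWithinAt G (Icc p 1) p := by
    rcases p.2.2.lt_or_eq with h | h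
    · exact (hG p ⟨p.2.1, h⟩).mono Icc_subset_Ici_self
    · rw [h, Icc_self]
      exact continuousWithinAt_singleton
  subst hp
  exact ContinuousWithinAt.comp (g := G) (t := Icc _ 1) hGp
    (continuous_subtype_val.comp continuous_projIcc).continuousWithinAt
    fun y (hxy : x ≤ y) => ⟨monotone_projIcc zero_le_one hxy, (projIcc 0 1 zero_le_one y).2.2⟩

theorem exists_subseq_tendsto_of_mem_monotoneInterval {u : ℕ → ℝ → ℝ}
    (hG : MonotoneOn G (Icc 0 1)) (hG' : ∀ x ∈ Ico (0 : ℝ) 1, ContinuousWithinAt G (Ici x) x)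
    (hu : ∀ n, u n ∈ monotoneInterval F G) :
    ∃ H ∈ monotoneInterval F G, ∃ ψ : ℕ → ℕ, StrictMono ψ ∧
      ∀ᵐ x, x ∈ uIoc (0 : ℝ) 1 → Tendsto (fun n => u (ψ n) x) atTop (𝓝 (H x)) := by
  have hext : ∀ (f : ℝ → ℝ), ∀ x ∈ Icc (0 : ℝ) 1,
      IccExtend zero_le_one ((Icc 0 1).domRestrict f) x = f x := fun f x hx =>
    IccExtend_of_mem _ _ hx
  have hmono : ∀ {f : ℝ → ℝ}, MonotoneOn f (Icc 0 1) →
      Monotone (IccExtend zero_le_one ((Icc 0 1).domRestrict f)) := fun hf =>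
    (monotoneOn_iff_monotone.1 hf).IccExtend _
  obtain ⟨H, ψ, hψ, hH, hcount⟩ := exists_subseq_tendsto_stieltjesFunction
    (u := fun n => IccExtend zero_le_one ((Icc 0 1).domRestrict (u n)))
    (f := IccExtend zero_le_one ((Icc 0 1).domRestrict F))
    (g := ⟨_, hmono hG, continuousWithinAt_IccExtend_Ici hG'⟩)
    (fun n => hmono (hu n).1) fun n x => (hu n).2.2 _ (projIcc 0 1 zero_le_one x).2
  refine ⟨H, ⟨H.mono.monotoneOn _, fun x _ => H.right_continuous x, fun x hx => ?_⟩, ψ, hψ, ?_⟩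
  · exact hext F x hx ▸ hext G x hx ▸ hH x
  · filter_upwards [hcount.ae_notMem volume] with x hx hx01
    rw [uIoc_of_le zero_le_one] at hx01
    simpa only [hext _ x (Ioc_subset_Icc_self hx01)] using not_not.1 hx

theorem exists_subseq_tendsto_of_mem_securities {u : ℕ → ℝ → ℝ} (hu : ∀ n, u n ∈ securities) :
    ∃ H ∈ securities, ∃ ψ : ℕ → ℕ, StrictMono ψ ∧
      ∀ᵐ x, x ∈ uIoc (0 : ℝ) 1 → Tendsto (fun n => u (ψ n) x) atTop (𝓝 (H x)) :=
  exists_subseq_tendsto_of_mem_monotoneInterval monotoneOn_id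
    (fun _ _ => continuousWithinAt_id) hu

theorem update_one_mem_monotoneInterval (hG : MonotoneOn G (Icc 0 1))
    (hH : H ∈ monotoneInterval F G) : Function.update H 1 (G 1) ∈ monotoneInterval F G := by
  have hne : ∀ {x : ℝ}, x ≠ 1 → Function.update H 1 (G 1) x = H x := fun hx =>
    Function.update_of_ne hx _ _
  have hbounds : ∀ x ∈ Icc (0 : ℝ) 1,
      F x ≤ Function.update H 1 (G 1) x ∧ Function.update H 1 (G 1) x ≤ G x := fun x hx => by
    rcases eq_or_ne x 1 with rfl | hx1
    · rw [Function.update_self]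
      exact ⟨(hH.2.2 1 hx).1.trans (hH.2.2 1 hx).2, le_rfl⟩
    · exact hne hx1 ▸ hH.2.2 x hx
  refine ⟨fun x hx y hy hxy => ?_, fun x hx => ?_, hbounds⟩
  · rcases hy.2.lt_or_eq with hy1 | rfl
    · rw [hne (hxy.trans_lt hy1).ne, hne hy1.ne]
      exact hH.1 hx hy hxy
    · rw [Function.update_self]
      exact (hbounds x hx).2.trans (hG hx hy hxy)
  · refine (hH.2.1 x hx).congr_of_eventuallyEq ?_ (hne hx.2.ne)
    filter_upwards [mem_nhdsWithin_of_mem_nhds (Iio_mem_nhds hx.2)] with y hy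
      using hne (ne_of_lt hy)

theorem exists_isMaxOn_of_subseq_tendsto {α : Type*} {J : α → ℝ} {K : Set α} (hK : K.Nonempty)
    (hsub : ∀ u : ℕ → α, (∀ n, u n ∈ K) →
      ∃ z ∈ K, ∃ ψ : ℕ → ℕ, StrictMono ψ ∧ Tendsto (fun n => J (u (ψ n))) atTop (𝓝 (J z))) :
    ∃ z ∈ K, IsMaxOn J K z := by
  set I : α → EReal := fun x => J x
  obtain ⟨a, -, ha, haK⟩ := exists_seq_tendsto_sSup (hK.image I) (OrderTop.bddAbove _)
  choose u hu hua using haK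
  obtain ⟨z, hz, ψ, hψ, hlim⟩ := hsub u hu
  have hsup : I z = sSup (I '' K) := by
    refine tendsto_nhds_unique ((continuous_coe_real_ereal.tendsto _).comp hlim)
      ((ha.comp hψ.tendsto_atTop).congr fun n => ?_)
    exact (hua (ψ n)).symm
  refine ⟨z, hz, fun x hx => EReal.coe_le_coe_iff.1 ?_⟩
  exact (le_sSup (mem_image_of_mem I hx)).trans hsup.ge

end Selection

section Integration

theorem intervalIntegrable_mul_of_monotoneOn {f w : ℝ → ℝ} {a b : ℝ} {μ : Measure ℝ}
    [IsLocallyFiniteMeasure μ] (hf : MonotoneOn f (uIcc a b)) (hw : IntervalIntegrable w μ a b) :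
    IntervalIntegrable (fun x => f x * w x) μ a b := by
  rw [intervalIntegrable_iff] at hw ⊢
  refine hw.bdd_mul (c := max |min (f a) (f b)| |max (f a) (f b)|)
    hf.intervalIntegrable.aestronglyMeasurable_restrict_uIoc ?_
  filter_upwards [ae_restrict_mem measurableSet_uIoc] with x hx
  have hfx : f x ∈ uIcc (f a) (f b) := hf.mapsTo_uIcc (uIoc_subset_uIcc hx)
  exact abs_le_max_abs_abs hfx.1 hfx.2

theorem monotoneOn_add_comp_of_lipschitzWith_one {α : Type*} [Preorder α] {f : α → ℝ} {s : Set α}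
    {η : ℝ → ℝ} (hf : MonotoneOn f s) (hη : LipschitzWith 1 η) :
    MonotoneOn (fun x => f x + η (f x)) s := fun x hx y hy hxy => by
  have hfxy := hf hx hy hxy
  have hle : |η (f x) - η (f y)| ≤ f y - f x := by
    simpa [Real.dist_eq, abs_sub_comm (f x), abs_of_nonneg (sub_nonneg.2 hfxy)] using
      hη.dist_le_mul (f x) (f y)
  linarith [le_abs_self (η (f x) - η (f y))]

theorem intervalIntegrable_comp_mul_of_lipschitzWith_one {f w η : ℝ → ℝ} {a b : ℝ}
    {μ : Measure ℝ} [IsLocallyFiniteMeasure μ] (hf : MonotoneOn f (uIcc a b))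
    (hη : LipschitzWith 1 η) (hw : IntervalIntegrable w μ a b) :
    IntervalIntegrable (fun x => η (f x) * w x) μ a b := by
  have hadd := intervalIntegrable_mul_of_monotoneOn
    (monotoneOn_add_comp_of_lipschitzWith_one hf hη) hw
  refine (hadd.sub (intervalIntegrable_mul_of_monotoneOn hf hw)).congr fun x _ => ?_
  ring

theorem hasDerivWithinAt_intervalIntegral_of_dominated {E : Type*} [NormedAddCommGroup E]
    [NormedSpace ℝ E] {F F' : ℝ → ℝ → E} {bound : ℝ → ℝ} {s : Set ℝ} {a b e : ℝ} {μ : Measure ℝ}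
    (hs : Convex ℝ s) (he : e ∈ s) (hF : ∀ t ∈ s, IntervalIntegrable (F t) μ a b)
    (hbound : IntervalIntegrable bound μ a b)
    (hle : ∀ x ∈ uIoc a b, ∀ t ∈ s, ‖F' t x‖ ≤ bound x)
    (hderiv : ∀ x ∈ uIoc a b, ∀ t ∈ s, HasDerivWithinAt (fun t => F t x) (F' t x) s t) :
    HasDerivWithinAt (fun t => ∫ x in a..b, F t x ∂μ) (∫ x in a..b, F' e x ∂μ) s e := by
  rw [hasDerivWithinAt_iff_tendsto_slope]
  have hslope : ∀ t ∈ s, slope (fun t => ∫ x in a..b, F t x ∂μ) e t =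
      ∫ x in a..b, slope (fun t => F t x) e t ∂μ := fun t ht => by
    simp only [slope_def_module]
    rw [intervalIntegral.integral_smul, intervalIntegral.integral_sub (hF t ht) (hF e he)]
  have hlim : Tendsto (fun t => ∫ x in a..b, slope (fun t => F t x) e t ∂μ) (𝓝[s \ {e}] e)
      (𝓝 (∫ x in a..b, F' e x ∂μ)) := by
    refine intervalIntegral.tendsto_integral_filter_of_dominated_convergence bound ?_ ?_ hbound ?_
    · filter_upwards [self_mem_nhdsWithin] with t ht
      simp only [slope_def_module]
      exact (((hF t ht.1).sub (hF e he)).smul _).aestronglyMeasurable_restrict_uIoc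
    · filter_upwards [self_mem_nhdsWithin] with t ht
      refine Eventually.of_forall fun x hx => ?_
      rw [slope_def_module, norm_smul, norm_inv, inv_mul_le_iff₀
        (norm_pos_iff.2 (sub_ne_zero.2 ht.2)), mul_comm]
      exact hs.norm_image_sub_le_of_norm_hasDerivWithin_le (hderiv x hx) (hle x hx) he ht.1
    · exact Eventually.of_forall fun x hx =>
        hasDerivWithinAt_iff_tendsto_slope.1 (hderiv x hx e he)
  refine hlim.congr' ?_
  filter_upwards [self_mem_nhdsWithin] with t ht using (hslope t ht.1).symm

theorem aestronglyMeasurable_of_hasDerivWithinAt {X E : Type*} [MeasurableSpace X]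
    {μ : Measure X} [NormedAddCommGroup E] [NormedSpace ℝ E] {F : ℝ → X → E} {F' : X → E}
    {s : Set ℝ} {e : ℝ} (he : e ∈ s) (hs : UniqueDiffWithinAt ℝ s e)
    (hF : ∀ t ∈ s, AEStronglyMeasurable (F t) μ)
    (hderiv : ∀ᵐ x ∂μ, HasDerivWithinAt (fun t => F t x) (F' x) s e) :
    AEStronglyMeasurable F' μ := by
  have : (𝓝[s \ {e}] e).NeBot := accPt_principal_iff_nhdsWithin.1 hs.accPt
  obtain ⟨t, ht, hts⟩ := exists_seq_forall_of_frequently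
    (eventually_mem_nhdsWithin (a := e) (s := s \ {e})).frequently
  refine aestronglyMeasurable_of_tendsto_ae atTop (f := fun n x => slope (fun t => F t x) e (t n))
    (fun n => ?_) ?_
  · simp only [slope_def_module]
    exact ((hF _ (hts n).1).sub (hF e he)).const_smul _
  · filter_upwards [hderiv] with x hx using (hasDerivWithinAt_iff_tendsto_slope.1 hx).comp ht

theorem intervalIntegral_update {E : Type*} [NormedAddCommGroup E] [NormedSpace ℝ E]
    {μ : Measure ℝ} [NullSingletonClass μ] (f : ℝ → ℝ → E) (H : ℝ → ℝ) (a b c y : ℝ) :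
    ∫ x in a..b, f x (Function.update H c y x) ∂μ = ∫ x in a..b, f x (H x) ∂μ := by
  refine intervalIntegral.integral_congr_ae ?_
  filter_upwards [Measure.ae_ne μ c] with x hx _
  rw [Function.update_of_ne hx]

theorem intervalIntegral_pos_of_continuousWithinAt_Ici {f : ℝ → ℝ} {a b y : ℝ}
    (hf : IntervalIntegrable f volume a b) (hnonneg : ∀ x, 0 ≤ f x) (hy : y ∈ Ico a b)
    (hcont : ContinuousWithinAt f (Ici y) y) (hpos : 0 < f y) : 0 < ∫ x in a..b, f x := by
  obtain ⟨z, hz, hyz⟩ := (mem_nhdsGE_iff_exists_mem_Ioc_Ico_subset hy.2).1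
    (hcont.eventually (lt_mem_nhds hpos))
  have hsub : uIcc y z ⊆ uIcc a b := by
    rw [uIcc_of_le hz.1.le, uIcc_of_le (hy.1.trans hy.2.le)]
    exact Icc_subset_Icc hy.1 hz.2
  have hpos_yz : 0 < ∫ x in y..z, f x :=
    intervalIntegral.intervalIntegral_pos_of_pos_on (hf.mono_set hsub)
      (fun x hx => hyz (Ioo_subset_Ico_self hx)) hz.1
  exact hpos_yz.trans_le (intervalIntegral.integral_mono_interval hy.1 hz.1.le hz.2
    (Eventually.of_forall hnonneg) hf)

theorem intervalIntegral_mul_self_nonpos_of_add_le_of_sub_le {f p : ℝ → ℝ} {a b : ℝ} {μ : Measure ℝ}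
    (hf : IntervalIntegrable (fun x => f x * f x) μ a b)
    (hadd : IntervalIntegrable (fun x => (f x + p x) * (f x + p x)) μ a b)
    (hsub : IntervalIntegrable (fun x => (f x - p x) * (f x - p x)) μ a b)
    (hadd_le : ∫ x in a..b, (f x + p x) * (f x + p x) ∂μ ≤ ∫ x in a..b, f x * f x ∂μ)
    (hsub_le : ∫ x in a..b, (f x - p x) * (f x - p x) ∂μ ≤ ∫ x in a..b, f x * f x ∂μ) :
    ∫ x in a..b, p x * p x ∂μ ≤ 0 := by
  have hparallelogram : ∀ x, p x * p x =
      2⁻¹ * ((f x + p x) * (f x + p x) + (f x - p x) * (f x - p x)) - f x * f x := fun x => by ring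
  simp only [hparallelogram]
  rw [intervalIntegral.integral_sub ((hadd.add hsub).const_mul _) hf,
    intervalIntegral.integral_const_mul, intervalIntegral.integral_add hadd hsub]
  linarith

variable {H w : ℝ → ℝ}

theorem monotoneOn_uIcc_of_mem_monotoneInterval {F G : ℝ → ℝ} (hH : H ∈ monotoneInterval F G) :
    MonotoneOn H (uIcc 0 1) := by
  rw [uIcc_of_le zero_le_one]
  exact hH.1

theorem norm_le_one_of_mem_securities (hH : H ∈ securities) {x : ℝ} (hx : x ∈ uIoc (0 : ℝ) 1) :
    ‖H x‖ ≤ 1 := by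
  rw [uIoc_of_le zero_le_one] at hx
  have hHx := hH.2.2 x (Ioc_subset_Icc_self hx)
  exact abs_le.2 ⟨by linarith, by linarith [hx.2]⟩

theorem id_mem_securities : (fun x : ℝ => x) ∈ securities :=
  ⟨monotoneOn_id, fun _ _ => continuousWithinAt_id, fun _ hx => ⟨hx.1, le_rfl⟩⟩

theorem intervalIntegrable_mul_of_mem_securities (hH : H ∈ securities)
    (hw : IntervalIntegrable w volume 0 1) :
    IntervalIntegrable (fun x => H x * w x) volume 0 1 :=
  intervalIntegrable_mul_of_monotoneOn (monotoneOn_uIcc_of_mem_monotoneInterval hH) hw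

theorem intervalIntegrable_of_mem_securities (hH : H ∈ securities) :
    IntervalIntegrable H volume 0 1 :=
  (monotoneOn_uIcc_of_mem_monotoneInterval hH).intervalIntegrable

theorem intervalIntegral_sub_mul_of_mem_securities (hH : H ∈ securities)
    (hw : IntervalIntegrable w volume 0 1) :
    ∫ x in (0 : ℝ)..1, (x - H x) * w x =
      (∫ x in (0 : ℝ)..1, x * w x) - ∫ x in (0 : ℝ)..1, H x * w x := by
  simp_rw [sub_mul]
  exact intervalIntegral.integral_sub
    (intervalIntegrable_mul_of_mem_securities id_mem_securities hw)
    (intervalIntegrable_mul_of_mem_securities hH hw)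

theorem tendsto_integral_mul_of_mem_securities {u : ℕ → ℝ → ℝ} {w : ℕ → ℝ → ℝ}
    {v bound : ℝ → ℝ} (hu : ∀ n, u n ∈ securities)
    (hlim : ∀ᵐ x, x ∈ uIoc (0 : ℝ) 1 → Tendsto (fun n => u n x) atTop (𝓝 (H x)))
    (hw : ∀ n, IntervalIntegrable (w n) volume 0 1)
    (hbound : IntervalIntegrable bound volume 0 1)
    (hle : ∀ n, ∀ x ∈ uIoc (0 : ℝ) 1, ‖w n x‖ ≤ bound x)
    (hwlim : ∀ᵐ x, x ∈ uIoc (0 : ℝ) 1 → Tendsto (fun n => w n x) atTop (𝓝 (v x))) :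
    Tendsto (fun n => ∫ x in (0 : ℝ)..1, u n x * w n x) atTop
      (𝓝 (∫ x in (0 : ℝ)..1, H x * v x)) := by
  refine intervalIntegral.tendsto_integral_filter_of_dominated_convergence bound
    (Eventually.of_forall fun n =>
      (intervalIntegrable_mul_of_mem_securities (hu n) (hw n)).aestronglyMeasurable_restrict_uIoc)
    (Eventually.of_forall fun n => Eventually.of_forall fun x hx => ?_) hbound ?_
  · rw [norm_mul]
    exact (mul_le_of_le_one_left (norm_nonneg _) (norm_le_one_of_mem_securities (hu n) hx)).trans
      (hle n x hx)
  · filter_upwards [hlim, hwlim] with x hux hwx hx using (hux hx).mul (hwx hx)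

end Integration

section CriticalPoints

variable {f f' : ℝ → ℝ} {a b c o : ℝ}

theorem mul_deriv_nonneg_of_isMinOn {s : Set ℝ} {f'c x : ℝ} (hf : HasDerivWithinAt f f'c s c)
    (hmin : IsMinOn f s c) (hsx : segment ℝ c x ⊆ s) : 0 ≤ (x - c) * f'c := by
  have := hmin.localize.hasFDerivWithinAt_nonneg hf.hasFDerivWithinAt
    (sub_mem_posTangentConeAt_of_segment_subset hsx)
  simpa using this

theorem isMinOn_uIcc_of_critical_isMax
    (hf : ∀ x ∈ Icc a b, HasDerivWithinAt f (f' x) (Icc a b) x)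
    (hcrit : ∀ x ∈ Icc a b, f' x = 0 → IsMaxOn f (Icc a b) x)
    (hc : c ∈ Icc a b) (hfc : f' c = 0) (ho : o ∈ Icc a b) : IsMinOn f (uIcc c o) o := by
  have hsub : uIcc c o ⊆ Icc a b := ordConnected_Icc.uIcc_subset hc ho
  have hmax := hcrit c hc hfc
  obtain ⟨m, hm, hmin⟩ := isCompact_uIcc.exists_isMinOn nonempty_uIcc
    (ContinuousOn.mono (fun x hx => (hf x hx).continuousWithinAt) hsub)
  -- An interior minimum is a critical point, hence a global maximum.
  have hcm : m ≠ o → f c ≤ f m := fun hmo => by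
    by_cases hmc : m = c
    · exact (congrArg f hmc).ge
    have hnhds : uIcc c o ∈ 𝓝 m := Icc_mem_nhds
      (hm.1.lt_of_ne fun h => (min_choice c o).elim (fun h' => hmc (h.symm.trans h'))
        fun h' => hmo (h.symm.trans h'))
      (hm.2.lt_of_ne fun h => (max_choice c o).elim (fun h' => hmc (h.trans h'))
        fun h' => hmo (h.trans h'))
    exact hcrit m (hsub hm) ((hmin.isLocalMin hnhds).hasDerivAt_eq_zero
      ((hf m (hsub hm)).hasDerivAt (mem_of_superset hnhds hsub))) hc
  intro x hx
  by_cases hmo : m = o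
  · exact hmo ▸ hmin hx
  · exact (hmax ho).trans ((hcm hmo).trans (hmin hx))

theorem mul_deriv_nonneg_of_critical_isMax
    (hf : ∀ x ∈ Icc a b, HasDerivWithinAt f (f' x) (Icc a b) x)
    (hcrit : ∀ x ∈ Icc a b, f' x = 0 → IsMaxOn f (Icc a b) x)
    (hc : c ∈ Icc a b) (hfc : f' c = 0) (ho : o ∈ Icc a b) : 0 ≤ (c - o) * f' o :=
  mul_deriv_nonneg_of_isMinOn
    ((hf o ho).mono (ordConnected_Icc.uIcc_subset hc ho))
    (isMinOn_uIcc_of_critical_isMax hf hcrit hc hfc ho)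
    (segment_symm ℝ c o ▸ segment_eq_uIcc c o ▸ Subset.rfl)

theorem deriv_left_nonneg_and_deriv_right_nonpos_of_critical_isMax
    (hf : ∀ x ∈ Icc a b, HasDerivWithinAt f (f' x) (Icc a b) x)
    (hcrit : ∀ x ∈ Icc a b, f' x = 0 → IsMaxOn f (Icc a b) x)
    (hc : c ∈ Icc a b) (hfc : f' c = 0) : 0 ≤ f' a ∧ f' b ≤ 0 := by
  have hab := hc.1.trans hc.2
  constructor
  · rcases hc.1.lt_or_eq with hac | rfl
    · exact nonneg_of_mul_nonneg_right (mul_deriv_nonneg_of_critical_isMax hf hcrit hc hfc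
        (left_mem_Icc.2 hab)) (sub_pos.2 hac)
    · exact hfc.ge
  · rcases hc.2.lt_or_eq with hcb | rfl
    · exact nonpos_of_mul_nonneg_right (mul_deriv_nonneg_of_critical_isMax hf hcrit hc hfc
        (right_mem_Icc.2 hab)) (sub_neg.2 hcb)
    · exact hfc.le

theorem deriv_eq_zero_of_isMaxOn_Icc (hf : HasDerivWithinAt f (f' c) (Icc a b) c)
    (hc : c ∈ Icc a b) (hmax : IsMaxOn f (Icc a b) c) (ha : 0 ≤ f' a) (hb : f' b ≤ 0) :
    f' c = 0 := by
  have hle : ∀ x ∈ Icc a b, (x - c) * f' c ≤ 0 := fun x hx => by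
    have := mul_deriv_nonneg_of_isMinOn hf.neg hmax.neg ((convex_Icc a b).segment_subset hc hx)
    linarith
  have hab := hc.1.trans hc.2
  refine le_antisymm ?_ ?_
  · rcases hc.2.lt_or_eq with hcb | rfl
    · exact nonpos_of_mul_nonpos_right (hle b (right_mem_Icc.2 hab)) (sub_pos.2 hcb)
    · exact hb
  · rcases hc.1.lt_or_eq with hac | rfl
    · exact nonneg_of_mul_nonpos_right (hle a (left_mem_Icc.2 hab)) (sub_neg.2 hac)
    · exact ha

end CriticalPoints

section ContingentDebt

/-- The face values of `H`, if `H` is a security: its values off the diagonal. -/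
def faceValues (H : ℝ → ℝ) : Set ℝ := {v | ∃ x ∈ Icc (0 : ℝ) 1, H x = v ∧ v < x}

/-- The values `v` of `H` with `H v < v`.  For a security these are the face values that lie below
every profit at which they are in effect, whatever intervals are used to describe `H`. -/
def nonDefaultableValues (H : ℝ → ℝ) : Set ℝ := {v ∈ H '' Icc 0 1 | H v < v}

/-- The smallest profit in `[0, 1]` at which `H` is at least `v`; this is a junk value unless
`v ≤ H 1`. -/
noncomputable def quantile (H : ℝ → ℝ) (v : ℝ) : ℝ := sInf {x ∈ Icc (0 : ℝ) 1 | v ≤ H x}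

variable {F G H : ℝ → ℝ} {v x : ℝ}

theorem isLeast_quantile (hH : H ∈ monotoneInterval F G) (hv : v ≤ H 1) :
    IsLeast {x ∈ Icc (0 : ℝ) 1 | v ≤ H x} (quantile H v) := by
  have hbdd : BddBelow {x ∈ Icc (0 : ℝ) 1 | v ≤ H x} := ⟨0, fun x hx => hx.1.1⟩
  have hone : (1 : ℝ) ∈ {x ∈ Icc (0 : ℝ) 1 | v ≤ H x} := ⟨right_mem_Icc.2 zero_le_one, hv⟩
  have hmem : quantile H v ∈ Icc (0 : ℝ) 1 :=
    ⟨le_csInf ⟨1, hone⟩ fun x hx => hx.1.1, csInf_le hbdd hone⟩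
  refine ⟨⟨hmem, ?_⟩, fun x hx => csInf_le hbdd hx⟩
  rcases hmem.2.lt_or_eq with hlt | heq
  · exact continuousWithinAt_const.closure_le (csInf_mem_closure ⟨1, hone⟩ hbdd)
      ((hH.2.1 _ ⟨hmem.1, hlt⟩).mono fun x hx => csInf_le hbdd hx) fun x hx => hx.2
  · rwa [heq]

theorem quantile_mem_Icc (hH : H ∈ monotoneInterval F G) (hv : v ≤ H 1) :
    quantile H v ∈ Icc (0 : ℝ) 1 :=
  (isLeast_quantile hH hv).1.1

theorem quantile_le_iff (hH : H ∈ monotoneInterval F G) (hv : v ≤ H 1) (hx : x ∈ Icc (0 : ℝ) 1) :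
    quantile H v ≤ x ↔ v ≤ H x :=
  ⟨fun h => (isLeast_quantile hH hv).1.2.trans (hH.1 (quantile_mem_Icc hH hv) hx h),
    fun h => (isLeast_quantile hH hv).2 ⟨hx, h⟩⟩

theorem apply_quantile (hH : H ∈ monotoneInterval F G) (hv : v ∈ H '' Icc 0 1) :
    H (quantile H v) = v := by
  obtain ⟨x, hx, rfl⟩ := hv
  have hx1 : H x ≤ H 1 := hH.1 hx (right_mem_Icc.2 zero_le_one) hx.2
  exact le_antisymm
    (hH.1 (quantile_mem_Icc hH hx1) hx ((quantile_le_iff hH hx1 hx).2 le_rfl))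
    (isLeast_quantile hH hx1).1.2

theorem faceValues_subset_image (H : ℝ → ℝ) : faceValues H ⊆ H '' Icc 0 1 :=
  fun _ ⟨x, hx, hxv, _⟩ => ⟨x, hx, hxv⟩

theorem lt_one_of_mem_faceValues (hv : v ∈ faceValues H) : v < 1 := by
  obtain ⟨x, hx, -, hvx⟩ := hv
  exact hvx.trans_le hx.2

theorem mem_nonDefaultableValues_of_mem_Ioo (hH : H ∈ securities) {y : ℝ}
    (hx : x ∈ Icc (0 : ℝ) 1) (hy : y ∈ Icc (0 : ℝ) 1) (hxy : H y ∈ Ioo (H x) x) :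
    H y ∈ nonDefaultableValues H :=
  ⟨mem_image_of_mem H hy,
    (hH.1 ⟨(hH.2.2 y hy).1, hxy.2.le.trans hx.2⟩ hx hxy.2.le).trans_lt hxy.1⟩

theorem countable_faceValues (hH : H ∈ securities) (hfin : (nonDefaultableValues H).Finite) :
    (faceValues H).Countable := by
  refine (hH.1.countable_setOfPred_two_preimages.union hfin.countable).mono ?_
  rintro v ⟨x, hx, hxv, hvx⟩
  have hv : v ∈ Icc (0 : ℝ) 1 := ⟨hxv ▸ (hH.2.2 x hx).1, hvx.le.trans hx.2⟩
  rcases (hH.2.2 v hv).2.lt_or_eq with hlt | heq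
  · exact Or.inr ⟨⟨x, hx, hxv⟩, hlt⟩
  · exact Or.inl ⟨v, x, hv, hx, hvx, heq, hxv⟩

theorem exists_gt_forall_lt_imp_le (hH : H ∈ securities) (hfin : (nonDefaultableValues H).Finite)
    (hv : v ∈ faceValues H) : ∃ v' ∈ Ioc v 1, ∀ x ∈ Icc (0 : ℝ) 1, v < H x → v' ≤ H x := by
  obtain ⟨x, hx, rfl, hvx⟩ := hv
  have hiso : (nonDefaultableValues H \ {H x})ᶜ ∈ 𝓝[>] H x :=
    mem_nhdsWithin_of_mem_nhds ((hfin.subset sdiff_subset).isClosed.compl_mem_nhds fun h => h.2 rfl)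
  obtain ⟨v', hv', hgap⟩ := (mem_nhdsGT_iff_exists_mem_Ioc_Ioo_subset hvx).1 hiso
  refine ⟨v', ⟨hv'.1, hv'.2.trans hx.2⟩, fun y hy hlt => ?_⟩
  by_contra! hyv'
  exact hgap ⟨hlt, hyv'⟩ ⟨mem_nonDefaultableValues_of_mem_Ioo hH hx hy
    ⟨hlt, hyv'.trans_le hv'.2⟩, hlt.ne'⟩

theorem exists_mem_Ico_quantile_iff (hH : H ∈ securities) (h1 : H 1 = 1)
    (hfin : (nonDefaultableValues H).Finite) (hv : v ∈ faceValues H) :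
    ∃ b, ∀ x ∈ Icc (0 : ℝ) 1, x ∈ Ico (quantile H v) b ↔ H x = v := by
  obtain ⟨v', hv', hgap⟩ := exists_gt_forall_lt_imp_le hH hfin hv
  refine ⟨quantile H v', fun x hx => ?_⟩
  rw [mem_Ico, quantile_le_iff hH ((lt_one_of_mem_faceValues hv).le.trans_eq h1.symm) hx,
    ← not_le, quantile_le_iff hH (hv'.2.trans_eq h1.symm) hx, not_le]
  exact ⟨fun h => h.1.antisymm' (le_of_not_gt fun hlt => (hgap x hx hlt).not_gt h.2),
    fun h => ⟨h.ge, h.trans_lt hv'.1⟩⟩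

theorem isContingentDebt_of_encard_nonDefaultableValues_le (hH : H ∈ securities) (h1 : H 1 = 1)
    {k : ℕ} (hk : (nonDefaultableValues H).encard ≤ k) : IsContingentDebt H k := by
  have hfin : (nonDefaultableValues H).Finite := finite_of_encard_le_coe hk
  have hle1 : ∀ v : faceValues H, (v : ℝ) ≤ H 1 := fun v =>
    (lt_one_of_mem_faceValues v.2).le.trans_eq h1.symm
  have hq : ∀ v : faceValues H, quantile H v ∈ Icc (0 : ℝ) 1 := fun v =>
    quantile_mem_Icc hH (hle1 v)
  have hHq : ∀ v : faceValues H, H (quantile H v) = v := fun v =>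
    apply_quantile hH (faceValues_subset_image H v.2)
  choose b hb using fun v : faceValues H => exists_mem_Ico_quantile_iff hH h1 hfin v.2
  have hqb : ∀ v : faceValues H, quantile H v ∈ Ico (quantile H v) (b v) := fun v =>
    (hb v _ (hq v)).2 (hHq v)
  refine ⟨faceValues H, fun v => quantile H v, b, (countable_faceValues hH hfin).to_subtype,
    ⟨hH, fun v => ⟨(hq v).1, (hq v).2.lt_of_ne fun h => ?_, (hqb v).2⟩, fun v x hx => ?_,
      fun x hx hout => ?_, fun v w hne => ?_⟩, (encard_le_encard ?_).trans hk⟩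
  · exact (lt_one_of_mem_faceValues v.2).ne (by rw [← hHq v, h, h1])
  · rw [(hb v x hx.2).1 hx.1, hHq v]
  · refine (hH.2.2 x hx).2.antisymm (le_of_not_gt fun hlt => ?_)
    exact hout ⟨H x, x, hx, rfl, hlt⟩ ((hb _ x hx).2 rfl)
  · rw [hHq v, hHq w]
    exact Subtype.coe_ne_coe.2 hne
  · rintro _ ⟨v, rfl, hlt⟩
    have hvq : (v : ℝ) < quantile H v := (hHq v).symm.trans_lt (hlt _ ⟨hqb v, hq v⟩)
    have hv : (v : ℝ) ∈ Icc (0 : ℝ) 1 :=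
      ⟨hHq v ▸ (hH.2.2 _ (hq v)).1, (lt_one_of_mem_faceValues v.2).le⟩
    rw [hHq v]
    exact ⟨faceValues_subset_image H v.2,
      lt_of_not_ge fun hle => hvq.not_ge ((quantile_le_iff hH (hle1 v) hv).2 hle)⟩

end ContingentDebt

section Tents

/-- The tent of height and half-width `δ` centred at `v`. -/
def tent (v δ w : ℝ) : ℝ := max 0 (δ - |w - v|)

/-- The linear combination with coefficients `t` of the tents of height and half-width `δ` centred
at the points `v i`: as a function `η` of the promised payment, the perturbation that turns a
security `H` into `H + η ∘ H`. -/
def tentSum {ι : Type*} [Fintype ι] (t v : ι → ℝ) (δ w : ℝ) : ℝ := ∑ i, t i * tent (v i) δ w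

theorem tent_nonneg (v δ w : ℝ) : 0 ≤ tent v δ w := le_max_left _ _

theorem tent_self {v δ : ℝ} (hδ : 0 ≤ δ) : tent v δ v = δ := by simp [tent, hδ]

theorem tent_eq_zero {v δ w : ℝ} (h : δ ≤ |w - v|) : tent v δ w = 0 :=
  max_eq_left (sub_nonpos.2 h)

theorem lipschitzWith_tent (v δ : ℝ) : LipschitzWith 1 (tent v δ) := by
  refine LipschitzWith.of_le_add fun w z => max_le ?_ ?_
  · exact add_nonneg (tent_nonneg v δ z) dist_nonneg
  · have h : δ - |z - v| ≤ tent v δ z := le_max_right _ _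
    rw [dist_comm, Real.dist_eq]
    linarith [abs_sub_le z w v]

theorem eventually_pairwise_le_abs_sub {ι : Type*} [Finite ι] {v : ι → ℝ}
    (hv : Function.Injective v) :
    ∀ᶠ δ in 𝓝[>] (0 : ℝ), ∀ i j, i ≠ j → δ ≤ |v j - v i| := by
  refine eventually_all.2 fun i => eventually_all.2 fun j => ?_
  by_cases hij : i = j
  · exact Eventually.of_forall fun _ h => absurd hij h
  · filter_upwards [Ioo_mem_nhdsGT (abs_pos.2 (sub_ne_zero.2 (hv.ne (Ne.symm hij))))] with δ hδ _
      using hδ.2.le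

variable {ι κ : Type*} [Fintype ι] {t v : ι → ℝ} {δ : ℝ}

theorem abs_sum_mul_le_of_sum_abs_le_one {f : ι → ℝ} {c : ℝ} (ht : ∑ i, |t i| ≤ 1) (hc : 0 ≤ c)
    (hf : ∀ i, |f i| ≤ c) : |∑ i, t i * f i| ≤ c :=
  calc |∑ i, t i * f i| ≤ ∑ i, |t i * f i| := Finset.abs_sum_le_sum_abs _ _
    _ ≤ ∑ i, |t i| * c := Finset.sum_le_sum fun i _ => by rw [abs_mul]; gcongr; exact hf i
    _ = (∑ i, |t i|) * c := (Finset.sum_mul ..).symm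
    _ ≤ c := mul_le_of_le_one_left hc ht

theorem lipschitzWith_tentSum (v : ι → ℝ) (δ : ℝ) (ht : ∑ i, |t i| ≤ 1) :
    LipschitzWith 1 (tentSum t v δ) := by
  refine LipschitzWith.of_dist_le_mul fun w z => ?_
  simp only [tentSum, Real.dist_eq, ← Finset.sum_sub_distrib, ← mul_sub, NNReal.coe_one, one_mul]
  refine abs_sum_mul_le_of_sum_abs_le_one ht (abs_nonneg _) fun i => ?_
  simpa only [Real.dist_eq, NNReal.coe_one, one_mul] using
    (lipschitzWith_tent (v i) δ).dist_le_mul w z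

theorem tentSum_apply_center (hδ : 0 ≤ δ) {j : ι} (hsep : ∀ i, i ≠ j → δ ≤ |v j - v i|) :
    tentSum t v δ (v j) = t j * δ := by
  rw [tentSum, Finset.sum_eq_single j, tent_self hδ]
  · exact fun i _ hij => by rw [tent_eq_zero (hsep i hij), mul_zero]
  · simp

theorem exists_ne_zero_sum_abs_le_one_mulVec_eq_zero_of_card_lt [Fintype κ] (A : Matrix κ ι ℝ)
    (h : Fintype.card κ < Fintype.card ι) :
    ∃ t : ι → ℝ, t ≠ 0 ∧ ∑ i, |t i| ≤ 1 ∧ A.mulVec t = 0 := by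
  obtain ⟨s, hsA, hs⟩ := (Submodule.ne_bot_iff _).1
    (LinearMap.ker_ne_bot_of_finrank_lt (f := A.mulVecLin) (by simpa using h))
  obtain ⟨i, hi⟩ := Function.ne_iff.1 hs
  have hpos : 0 < ∑ i, |s i| :=
    Finset.sum_pos' (fun _ _ => abs_nonneg _) ⟨i, Finset.mem_univ _, abs_pos.2 hi⟩
  refine ⟨(∑ i, |s i|)⁻¹ • s, smul_ne_zero (inv_ne_zero hpos.ne') hs, ?_, ?_⟩
  · simp only [Pi.smul_apply, smul_eq_mul, abs_mul, ← Finset.mul_sum, abs_of_pos (inv_pos.2 hpos),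
      inv_mul_cancel₀ hpos.ne', le_refl]
  · rw [Matrix.mulVec_smul, ← Matrix.mulVecLin_apply, LinearMap.mem_ker.1 hsA, smul_zero]

end Tents

section Moments

/-- The integrals of `H` over `[0, 1]` against the weights `w j`. -/
noncomputable def moments {κ : Type*} (w : κ → ℝ → ℝ) (H : ℝ → ℝ) : κ → ℝ :=
  fun j => ∫ x in (0 : ℝ)..1, H x * w j x

variable {ι κ : Type*} {w : κ → ℝ → ℝ} {H η : ℝ → ℝ}

theorem moments_add_comp (hw : ∀ j, IntervalIntegrable (w j) volume 0 1)
    (hH : MonotoneOn H (uIcc 0 1)) (hη : LipschitzWith 1 η) :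
    moments w (fun x => H x + η (H x)) = moments w H + moments w fun x => η (H x) := by
  funext j
  simp only [moments, Pi.add_apply, add_mul]
  exact intervalIntegral.integral_add (intervalIntegrable_mul_of_monotoneOn hH (hw j))
    (intervalIntegrable_comp_mul_of_lipschitzWith_one hH hη (hw j))

theorem moments_neg (w : κ → ℝ → ℝ) (H : ℝ → ℝ) : moments w (fun x => -H x) = -moments w H := by
  funext j
  simp [moments]

theorem moments_tentSum_comp [Fintype ι] (hw : ∀ j, IntervalIntegrable (w j) volume 0 1)
    (hH : MonotoneOn H (uIcc 0 1)) (t v : ι → ℝ) (δ : ℝ) :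
    moments w (fun x => tentSum t v δ (H x)) =
      (Matrix.of fun j i => ∫ x in (0 : ℝ)..1, tent (v i) δ (H x) * w j x).mulVec t := by
  funext j
  simp only [moments, tentSum, Finset.sum_mul, Matrix.mulVec, dotProduct, Matrix.of_apply,
    mul_assoc]
  rw [intervalIntegral.integral_finsetSum fun i _ =>
    (intervalIntegrable_comp_mul_of_lipschitzWith_one hH (lipschitzWith_tent _ _) (hw j)).const_mul
      _]
  simp only [intervalIntegral.integral_const_mul, mul_comm]

theorem moments_update (w : κ → ℝ → ℝ) (H : ℝ → ℝ) (c y : ℝ) :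
    moments w (Function.update H c y) = moments w H :=
  funext fun j => intervalIntegral_update (fun x h => h * w j x) H 0 1 c y

end Moments

section Extremality

variable {κ : Type*} {w : κ → ℝ → ℝ} {F G H η : ℝ → ℝ}

theorem add_comp_mem_monotoneInterval (hH : H ∈ monotoneInterval F G) (hη : LipschitzWith 1 η)
    (hbound : ∀ x ∈ Icc (0 : ℝ) 1, |η (H x)| ≤ H x - F x ∧ |η (H x)| ≤ G x - H x) :
    (fun x => H x + η (H x)) ∈ monotoneInterval F G := by
  refine ⟨monotoneOn_add_comp_of_lipschitzWith_one hH.1 hη, fun x hx => ?_, fun x hx => ?_⟩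
  · exact (hH.2.1 x hx).add (hη.continuous.continuousAt.comp_continuousWithinAt (hH.2.1 x hx))
  · obtain ⟨hF, hG⟩ := hbound x hx
    constructor
    · linarith [neg_abs_le (η (H x))]
    · linarith [le_abs_self (η (H x))]

theorem mem_Ioo_of_mem_nonDefaultableValues (hH : H ∈ securities) {v : ℝ}
    (hv : v ∈ nonDefaultableValues H) : v ∈ Ioo (0 : ℝ) 1 := by
  obtain ⟨⟨y, hy, rfl⟩, hlt⟩ := hv
  have hle : H y ≤ y := (hH.2.2 y hy).2
  have hmem : H y ∈ Icc (0 : ℝ) 1 := ⟨(hH.2.2 y hy).1, hle.trans hy.2⟩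
  refine ⟨(hH.2.2 _ hmem).1.trans_lt hlt, hmem.2.lt_of_ne fun h => hlt.ne ?_⟩
  have hy1 : y = 1 := hy.2.antisymm (h ▸ hle)
  rw [h, ← hy1, h, hy1]

theorem eventually_tent_le_and_tent_le_sub (hH : H ∈ securities) {v : ℝ}
    (hv : v ∈ nonDefaultableValues H) :
    ∀ᶠ δ in 𝓝[>] (0 : ℝ), ∀ x ∈ Icc (0 : ℝ) 1,
      tent v δ (H x) ≤ H x ∧ tent v δ (H x) ≤ x - H x := by
  have hv01 := mem_Ioo_of_mem_nonDefaultableValues hH hv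
  obtain ⟨m, hHm, hmv⟩ := exists_between hv.2
  obtain ⟨z, hvz : v < z, hz⟩ := mem_nhdsGE_iff_exists_Ico_subset.1
    ((hH.2.1 v (Ioo_subset_Ico_self hv01)).eventually (gt_mem_nhds hHm))
  have hz_le : ∀ x ∈ Icc (0 : ℝ) 1, m < H x → z ≤ x := fun x hx hmx => by
    by_contra! hxz
    rcases le_total v x with hvx | hxv
    · exact hmx.not_gt (hz ⟨hvx, hxz⟩)
    · exact hmx.not_ge ((hH.1 hx (Ioo_subset_Icc_self hv01) hxv).trans hHm.le)
  filter_upwards [Ioo_mem_nhdsGT hv01.1, Ioo_mem_nhdsGT (sub_pos.2 hmv),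
    Ioo_mem_nhdsGT (half_pos (sub_pos.2 hvz))] with δ hδv hδm hδz x hx
  obtain ⟨h0, hxH⟩ := hH.2.2 x hx
  rcases le_or_gt δ |H x - v| with hfar | hnear
  · rw [tent_eq_zero hfar]
    exact ⟨h0, sub_nonneg.2 hxH⟩
  · have hclose := abs_lt.1 hnear
    have hzx := hz_le x hx (by linarith [hδm.2])
    have htent : tent v δ (H x) ≤ δ - |H x - v| := max_le (by linarith) le_rfl
    constructor
    · linarith [neg_abs_le (H x - v), hδv.2]
    · linarith [abs_nonneg (H x - v), hδz.2]

theorem exists_lipschitzWith_one_moments_eq_zero {ι : Type*} [Fintype ι] [Fintype κ]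
    (hH : H ∈ securities) (h1 : H 1 = 1)
    (hw : ∀ j, IntervalIntegrable (w j) volume 0 1) {v : ι → ℝ} (hv : Function.Injective v)
    (hvH : ∀ i, v i ∈ nonDefaultableValues H) (hcard : Fintype.card κ < Fintype.card ι) :
    ∃ η : ℝ → ℝ, LipschitzWith 1 η ∧
      (∀ x ∈ Icc (0 : ℝ) 1, |η (H x)| ≤ H x ∧ |η (H x)| ≤ x - H x) ∧
      moments w (fun x => η (H x)) = 0 ∧ ∃ y ∈ Ico (0 : ℝ) 1, η (H y) ≠ 0 := by
  obtain ⟨δ, hδ : 0 < δ, hsep, hsmall⟩ := (eventually_mem_nhdsWithin.and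
    ((eventually_pairwise_le_abs_sub hv).and
      (eventually_all.2 fun i => eventually_tent_le_and_tent_le_sub hH (hvH i)))).exists
  obtain ⟨t, ht0, ht1, htA⟩ := exists_ne_zero_sum_abs_le_one_mulVec_eq_zero_of_card_lt
    (Matrix.of fun j i => ∫ x in (0 : ℝ)..1, tent (v i) δ (H x) * w j x) hcard
  refine ⟨tentSum t v δ, lipschitzWith_tentSum v δ ht1, fun x hx => ?_, ?_, ?_⟩
  · have habs : ∀ i, |tent (v i) δ (H x)| = tent (v i) δ (H x) := fun i =>
      abs_of_nonneg (tent_nonneg _ _ _)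
    obtain ⟨h0, hxH⟩ := hH.2.2 x hx
    constructor
    · exact abs_sum_mul_le_of_sum_abs_le_one ht1 h0 fun i => (habs i).trans_le (hsmall i x hx).1
    · exact abs_sum_mul_le_of_sum_abs_le_one ht1 (sub_nonneg.2 hxH) fun i =>
        (habs i).trans_le (hsmall i x hx).2
  · rw [moments_tentSum_comp hw (monotoneOn_uIcc_of_mem_monotoneInterval hH), htA]
  · obtain ⟨j, hj⟩ := Function.ne_iff.1 ht0
    obtain ⟨y, hy, hyv⟩ := (hvH j).1
    refine ⟨y, ⟨hy.1, hy.2.lt_of_ne fun h => ?_⟩, ?_⟩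
    · exact (mem_Ioo_of_mem_nonDefaultableValues hH (hvH j)).2.ne (by rw [← hyv, h, h1])
    · rw [hyv, tentSum_apply_center hδ.le fun i hij => hsep i j hij]
      exact mul_ne_zero hj hδ.ne'

theorem add_comp_mem_setOf_moments_eq (hH : H ∈ securities)
    (hw : ∀ j, IntervalIntegrable (w j) volume 0 1) (hη : LipschitzWith 1 η)
    (hbound : ∀ x ∈ Icc (0 : ℝ) 1, |η (H x)| ≤ H x ∧ |η (H x)| ≤ x - H x)
    (hηw : moments w (fun x => η (H x)) = 0) :
    (fun x => H x + η (H x)) ∈ {G ∈ securities | moments w G = moments w H} :=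
  ⟨add_comp_mem_monotoneInterval hH hη (by simpa only [sub_zero] using hbound), by
    rw [moments_add_comp hw (monotoneOn_uIcc_of_mem_monotoneInterval hH) hη, hηw, add_zero]⟩

theorem comp_eq_zero_of_isMaxOn_integral_mul_self (hH : H ∈ securities)
    (hw : ∀ j, IntervalIntegrable (w j) volume 0 1)
    (hmax : IsMaxOn (fun G => ∫ x in (0 : ℝ)..1, G x * G x)
      {G ∈ securities | moments w G = moments w H} H)
    (hη : LipschitzWith 1 η)
    (hbound : ∀ x ∈ Icc (0 : ℝ) 1, |η (H x)| ≤ H x ∧ |η (H x)| ≤ x - H x)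
    (hηw : moments w (fun x => η (H x)) = 0) {y : ℝ} (hy : y ∈ Ico (0 : ℝ) 1) :
    η (H y) = 0 := by
  have hadd := add_comp_mem_setOf_moments_eq hH hw hη hbound hηw
  have hsub : (fun x => H x - η (H x)) ∈ {G ∈ securities | moments w G = moments w H} := by
    have := add_comp_mem_setOf_moments_eq hH hw hη.neg (by simpa only [Pi.neg_apply, abs_neg])
      (by rw [← neg_eq_zero, ← moments_neg]; simpa only [Pi.neg_apply, neg_neg])
    simpa only [Pi.neg_apply, ← sub_eq_add_neg] using this
  have hsq : ∀ {f : ℝ → ℝ}, f ∈ securities → IntervalIntegrable (fun x => f x * f x) volume 0 1 :=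
    fun hf => intervalIntegrable_mul_of_mem_securities hf (intervalIntegrable_of_mem_securities hf)
  have hnonpos := intervalIntegral_mul_self_nonpos_of_add_le_of_sub_le (hsq hH)
    (hsq hadd.1) (hsq hsub.1) (hmax hadd) (hmax hsub)
  by_contra hηy
  have hcont : ContinuousWithinAt (fun x => η (H x)) (Ici y) y :=
    hη.continuous.continuousAt.comp_continuousWithinAt (hH.2.1 y hy)
  have hmono := monotoneOn_uIcc_of_mem_monotoneInterval hH
  have hint : IntervalIntegrable (fun x => η (H x)) volume 0 1 := by
    simpa only [mul_one] using
      intervalIntegrable_comp_mul_of_lipschitzWith_one hmono hη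
        (intervalIntegrable_const (c := (1 : ℝ)))
  exact hnonpos.not_gt (intervalIntegral_pos_of_continuousWithinAt_Ici
    (intervalIntegrable_comp_mul_of_lipschitzWith_one hmono hη hint)
    (fun x => mul_self_nonneg _) hy (hcont.mul hcont) (mul_self_pos.2 hηy))

theorem encard_nonDefaultableValues_le_card [Fintype κ] (hH : H ∈ securities) (h1 : H 1 = 1)
    (hw : ∀ j, IntervalIntegrable (w j) volume 0 1)
    (hmax : IsMaxOn (fun G => ∫ x in (0 : ℝ)..1, G x * G x)
      {G ∈ securities | moments w G = moments w H} H) :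
    (nonDefaultableValues H).encard ≤ Fintype.card κ := by
  by_contra! hlt
  obtain ⟨T, hTH, hT⟩ := exists_subset_encard_eq (Order.add_one_le_of_lt hlt)
  have hTfin : T.Finite := finite_of_encard_eq_coe (k := Fintype.card κ + 1) (by simpa using hT)
  have : Fintype T := hTfin.fintype
  have hcard : Fintype.card κ < Fintype.card T := by
    rw [encard_eq_coe_toFinset_card, toFinset_card] at hT
    exact Nat.lt_of_succ_le (by exact_mod_cast hT.ge)
  obtain ⟨η, hη, hbound, hηw, y, hy, hηy⟩ := exists_lipschitzWith_one_moments_eq_zero hH h1 hw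
    Subtype.val_injective (fun i : T => hTH i.2) hcard
  exact hηy (comp_eq_zero_of_isMaxOn_integral_mul_self hH hw hmax hη hbound hηw hy)

theorem exists_isMaxOn_integral_mul_self (hH : H ∈ securities)
    (hw : ∀ j, IntervalIntegrable (w j) volume 0 1) :
    ∃ F ∈ {G ∈ securities | moments w G = moments w H},
      IsMaxOn (fun G => ∫ x in (0 : ℝ)..1, G x * G x)
        {G ∈ securities | moments w G = moments w H} F := by
  refine exists_isMaxOn_of_subseq_tendsto ⟨H, hH, rfl⟩ fun u hu => ?_
  obtain ⟨F, hF, ψ, hψ, hlim⟩ := exists_subseq_tendsto_of_mem_securities fun n => (hu n).1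
  have hmoments : moments w F = moments w H := funext fun j => by
    refine tendsto_nhds_unique (tendsto_integral_mul_of_mem_securities (fun n => (hu (ψ n)).1) hlim
      (fun _ => hw j) (hw j).norm (fun _ _ _ => le_rfl)
      (Eventually.of_forall fun _ _ => tendsto_const_nhds)) ?_
    exact tendsto_const_nhds.congr fun n => (congrFun (hu (ψ n)).2 j).symm
  exact ⟨F, ⟨hF, hmoments⟩, ψ, hψ, tendsto_integral_mul_of_mem_securities (fun n => (hu (ψ n)).1)
    hlim (fun n => intervalIntegrable_of_mem_securities (hu (ψ n)).1)
    (intervalIntegrable_const (c := (1 : ℝ)))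
    (fun n x hx => norm_le_one_of_mem_securities (hu (ψ n)).1 hx) hlim⟩

theorem exists_isContingentDebt_moments_eq [Fintype κ] (hH : H ∈ securities)
    (hw : ∀ j, IntervalIntegrable (w j) volume 0 1) :
    ∃ G ∈ securities, IsContingentDebt G (Fintype.card κ) ∧ moments w G = moments w H := by
  obtain ⟨F, ⟨hF, hFw⟩, hmax⟩ := exists_isMaxOn_integral_mul_self hH hw
  have hG : Function.update F 1 1 ∈ securities :=
    update_one_mem_monotoneInterval monotoneOn_id hF
  have hGw : moments w (Function.update F 1 1) = moments w H := (moments_update ..).trans hFw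
  refine ⟨_, hG, ?_, hGw⟩
  refine isContingentDebt_of_encard_nonDefaultableValues_le hG (Function.update_self ..)
    (encard_nonDefaultableValues_le_card hG (Function.update_self ..) hw fun K hK => ?_)
  exact (hmax (hGw ▸ hK)).trans_eq (intervalIntegral_update (fun _ h => h * h) F 0 1 1 1).symm

end Extremality

namespace MoralHazard

/-- The first-order approach is valid: every effort that satisfies the first-order condition solves
the entrepreneur's effort problem. -/
def FirstOrderApproach (M : MoralHazard) : Prop :=
  ∀ H ∈ securities, ∀ e ∈ Icc 0 M.ebar, M.FOC H e → M.SolvesEffort H e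

/-- The derivative of the entrepreneur's expected payoff in effort. -/
noncomputable def marginalPayoff (M : MoralHazard) (H : ℝ → ℝ) (e : ℝ) : ℝ :=
  (∫ x in (0 : ℝ)..1, (x - H x) * M.φe e x) - M.C' e

variable (M : MoralHazard) {G H : ℝ → ℝ} {e x : ℝ}

theorem FOC_iff_marginalPayoff_eq_zero : M.FOC H e ↔ M.marginalPayoff H e = 0 :=
  sub_eq_zero.symm

theorem zero_mem_Icc_ebar : (0 : ℝ) ∈ Icc 0 M.ebar := left_mem_Icc.2 M.ebar_pos.le

theorem ebar_mem_Icc_ebar : M.ebar ∈ Icc 0 M.ebar := right_mem_Icc.2 M.ebar_pos.le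

theorem intervalIntegrable_φ (he : e ∈ Icc 0 M.ebar) : IntervalIntegrable (M.φ e) volume 0 1 :=
  (intervalIntegrable_iff_integrableOn_Icc_of_le zero_le_one).2 (M.φ_integrable e he)

theorem hasDerivWithinAt_φ (hx : x ∈ uIoc (0 : ℝ) 1) (he : e ∈ Icc 0 M.ebar) :
    HasDerivWithinAt (fun t => M.φ t x) (M.φe e x) (Icc 0 M.ebar) e := by
  rw [uIoc_of_le zero_le_one] at hx
  exact (M.φ_differentiable x (Ioc_subset_Icc_self hx) e he).hasDerivWithinAt

theorem exists_intervalIntegrable_norm_φe_le : ∃ g : ℝ → ℝ, IntervalIntegrable g volume 0 1 ∧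
    ∀ x ∈ uIoc (0 : ℝ) 1, ∀ e ∈ Icc 0 M.ebar, ‖M.φe e x‖ ≤ g x := by
  obtain ⟨g, hg, hle⟩ := M.φ_dominated
  rw [uIoc_of_le zero_le_one]
  exact ⟨g, (intervalIntegrable_iff_integrableOn_Icc_of_le zero_le_one).2 hg,
    fun x hx e he => hle e he x (Ioc_subset_Icc_self hx)⟩

theorem exists_intervalIntegrable_norm_φ_le : ∃ g : ℝ → ℝ, IntervalIntegrable g volume 0 1 ∧
    ∀ x ∈ uIoc (0 : ℝ) 1, ∀ e ∈ Icc 0 M.ebar, ‖M.φ e x‖ ≤ g x := by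
  obtain ⟨g, hg, hle⟩ := M.exists_intervalIntegrable_norm_φe_le
  refine ⟨fun x => ‖M.φ 0 x‖ + g x * M.ebar,
    (M.intervalIntegrable_φ M.zero_mem_Icc_ebar).norm.add (hg.mul_const _), fun x hx e he => ?_⟩
  have hlip : ‖M.φ e x - M.φ 0 x‖ ≤ g x * ‖e - 0‖ :=
    (convex_Icc 0 M.ebar).norm_image_sub_le_of_norm_hasDerivWithin_le
      (fun t ht => M.hasDerivWithinAt_φ hx ht) (hle x hx) M.zero_mem_Icc_ebar he
  rw [sub_zero, Real.norm_of_nonneg he.1] at hlip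
  have hg0 : 0 ≤ g x := (norm_nonneg _).trans (hle x hx e he)
  calc ‖M.φ e x‖ ≤ ‖M.φ 0 x‖ + ‖M.φ e x - M.φ 0 x‖ := norm_le_norm_add_norm_sub' _ _
    _ ≤ ‖M.φ 0 x‖ + g x * M.ebar := by gcongr; exact hlip.trans (by gcongr; exact he.2)

theorem intervalIntegrable_φe (he : e ∈ Icc 0 M.ebar) :
    IntervalIntegrable (M.φe e) volume 0 1 := by
  obtain ⟨g, hg, hle⟩ := M.exists_intervalIntegrable_norm_φe_le
  refine hg.mono_fun' (aestronglyMeasurable_of_hasDerivWithinAt he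
    (uniqueDiffOn_Icc M.ebar_pos e he)
    (fun t ht => (M.intervalIntegrable_φ ht).aestronglyMeasurable_restrict_uIoc) ?_) ?_
  · filter_upwards [ae_restrict_mem measurableSet_uIoc] with x hx using M.hasDerivWithinAt_φ hx he
  · filter_upwards [ae_restrict_mem measurableSet_uIoc] with x hx using hle x hx e he

theorem hasDerivWithinAt_integral_mul_φ (hH : H ∈ securities) (he : e ∈ Icc 0 M.ebar) :
    HasDerivWithinAt (fun t => ∫ x in (0 : ℝ)..1, H x * M.φ t x)
      (∫ x in (0 : ℝ)..1, H x * M.φe e x) (Icc 0 M.ebar) e := by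
  obtain ⟨g, hg, hle⟩ := M.exists_intervalIntegrable_norm_φe_le
  refine hasDerivWithinAt_intervalIntegral_of_dominated (convex_Icc 0 M.ebar) he
    (fun t ht => intervalIntegrable_mul_of_mem_securities hH (M.intervalIntegrable_φ ht)) hg
    (fun x hx t ht => ?_) fun x hx t ht => (M.hasDerivWithinAt_φ hx ht).const_mul _
  rw [norm_mul]
  exact (mul_le_of_le_one_left (norm_nonneg _) (norm_le_one_of_mem_securities hH hx)).trans
    (hle x hx t ht)

theorem payoff_eq (hH : H ∈ securities) (he : e ∈ Icc 0 M.ebar) :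
    M.payoff H e =
      (∫ x in (0 : ℝ)..1, x * M.φ e x) - (∫ x in (0 : ℝ)..1, H x * M.φ e x) - M.C e := by
  rw [payoff, intervalIntegral_sub_mul_of_mem_securities hH (M.intervalIntegrable_φ he)]

theorem marginalPayoff_eq (hH : H ∈ securities) (he : e ∈ Icc 0 M.ebar) :
    M.marginalPayoff H e =
      (∫ x in (0 : ℝ)..1, x * M.φe e x) - (∫ x in (0 : ℝ)..1, H x * M.φe e x) - M.C' e := by
  rw [marginalPayoff, intervalIntegral_sub_mul_of_mem_securities hH (M.intervalIntegrable_φe he)]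

theorem hasDerivWithinAt_payoff (hH : H ∈ securities) (he : e ∈ Icc 0 M.ebar) :
    HasDerivWithinAt (M.payoff H) (M.marginalPayoff H e) (Icc 0 M.ebar) e := by
  rw [M.marginalPayoff_eq hH he]
  exact (((M.hasDerivWithinAt_integral_mul_φ id_mem_securities he).sub
    (M.hasDerivWithinAt_integral_mul_φ hH he)).sub
    (M.C_differentiable e he).hasDerivWithinAt).congr_of_mem (fun t ht => M.payoff_eq hH ht) he

section Limits

variable {u : ℕ → ℝ → ℝ} {s : ℕ → ℝ}

theorem tendsto_integral_mul_φ (hu : ∀ n, u n ∈ securities)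
    (hlim : ∀ᵐ x, x ∈ uIoc (0 : ℝ) 1 → Tendsto (fun n => u n x) atTop (𝓝 (H x)))
    (hs : ∀ n, s n ∈ Icc 0 M.ebar) (he : e ∈ Icc 0 M.ebar) (hse : Tendsto s atTop (𝓝 e)) :
    Tendsto (fun n => ∫ x in (0 : ℝ)..1, u n x * M.φ (s n) x) atTop
      (𝓝 (∫ x in (0 : ℝ)..1, H x * M.φ e x)) := by
  obtain ⟨g, hg, hle⟩ := M.exists_intervalIntegrable_norm_φ_le
  refine tendsto_integral_mul_of_mem_securities hu hlim (fun n => M.intervalIntegrable_φ (hs n)) hg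
    (fun n x hx => hle x hx _ (hs n)) (Eventually.of_forall fun x hx => ?_)
  exact (M.hasDerivWithinAt_φ hx he).continuousWithinAt.tendsto.comp
    (tendsto_nhdsWithin_iff.2 ⟨hse, Eventually.of_forall hs⟩)

theorem tendsto_payoff (hu : ∀ n, u n ∈ securities) (hH : H ∈ securities)
    (hlim : ∀ᵐ x, x ∈ uIoc (0 : ℝ) 1 → Tendsto (fun n => u n x) atTop (𝓝 (H x)))
    (hs : ∀ n, s n ∈ Icc 0 M.ebar) (he : e ∈ Icc 0 M.ebar) (hse : Tendsto s atTop (𝓝 e)) :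
    Tendsto (fun n => M.payoff (u n) (s n)) atTop (𝓝 (M.payoff H e)) := by
  rw [M.payoff_eq hH he]
  simp only [fun n => M.payoff_eq (hu n) (hs n)]
  refine ((M.tendsto_integral_mul_φ (fun _ => id_mem_securities)
    (Eventually.of_forall fun _ _ => tendsto_const_nhds) hs he hse).sub
    (M.tendsto_integral_mul_φ hu hlim hs he hse)).sub ?_
  exact (M.C_differentiable e he).continuousWithinAt.tendsto.comp
    (tendsto_nhdsWithin_iff.2 ⟨hse, Eventually.of_forall hs⟩)

theorem tendsto_marginalPayoff (hu : ∀ n, u n ∈ securities) (hH : H ∈ securities)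
    (hlim : ∀ᵐ x, x ∈ uIoc (0 : ℝ) 1 → Tendsto (fun n => u n x) atTop (𝓝 (H x)))
    (he : e ∈ Icc 0 M.ebar) :
    Tendsto (fun n => M.marginalPayoff (u n) e) atTop (𝓝 (M.marginalPayoff H e)) := by
  have hφe := M.intervalIntegrable_φe he
  rw [M.marginalPayoff_eq hH he]
  simp only [fun n => M.marginalPayoff_eq (hu n) he]
  exact ((tendsto_integral_mul_of_mem_securities hu hlim (fun _ => hφe) hφe.norm
    (fun _ _ _ => le_rfl)
    (Eventually.of_forall fun _ _ => tendsto_const_nhds)).const_sub _).sub_const _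

end Limits

variable {M}

namespace FirstOrderApproach

theorem marginalPayoff_zero_nonneg_and_ebar_nonpos (hfoa : M.FirstOrderApproach)
    (hfeas : M.Feasible H e) : 0 ≤ M.marginalPayoff H 0 ∧ M.marginalPayoff H M.ebar ≤ 0 :=
  deriv_left_nonneg_and_deriv_right_nonpos_of_critical_isMax
    (fun _ hx => M.hasDerivWithinAt_payoff hfeas.1 hx)
    (fun x hx h => (hfoa H hfeas.1 x hx (M.FOC_iff_marginalPayoff_eq_zero.2 h)).2) hfeas.2.1
    (M.FOC_iff_marginalPayoff_eq_zero.1 hfeas.2.2.1)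

theorem feasible_of_tendsto (hfoa : M.FirstOrderApproach) {u : ℕ → ℝ → ℝ} {s : ℕ → ℝ}
    (hfeas : ∀ n, M.Feasible (u n) (s n)) (hH : H ∈ securities)
    (hlim : ∀ᵐ x, x ∈ uIoc (0 : ℝ) 1 → Tendsto (fun n => u n x) atTop (𝓝 (H x)))
    (hse : Tendsto s atTop (𝓝 e)) : M.Feasible H e := by
  have hu : ∀ n, u n ∈ securities := fun n => (hfeas n).1
  have hs : ∀ n, s n ∈ Icc 0 M.ebar := fun n => (hfeas n).2.1
  have he : e ∈ Icc 0 M.ebar := isClosed_Icc.mem_of_tendsto hse (Eventually.of_forall hs)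
  have hmax : IsMaxOn (M.payoff H) (Icc 0 M.ebar) e := fun x hx =>
    le_of_tendsto_of_tendsto'
      (M.tendsto_payoff hu hH hlim (fun _ => hx) hx tendsto_const_nhds)
      (M.tendsto_payoff hu hH hlim hs he hse)
      fun n => (hfoa _ (hu n) _ (hs n) (hfeas n).2.2.1).2 x hx
  -- `φ_e` need not be continuous in effort, so the limit of the first-order conditions is read off
  -- from the maximality of `e` and from the signs of the marginal payoff at the end points.
  have hzero : 0 ≤ M.marginalPayoff H 0 :=
    ge_of_tendsto' (M.tendsto_marginalPayoff hu hH hlim M.zero_mem_Icc_ebar) fun n =>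
      (hfoa.marginalPayoff_zero_nonneg_and_ebar_nonpos (hfeas n)).1
  have hebar : M.marginalPayoff H M.ebar ≤ 0 :=
    le_of_tendsto' (M.tendsto_marginalPayoff hu hH hlim M.ebar_mem_Icc_ebar) fun n =>
      (hfoa.marginalPayoff_zero_nonneg_and_ebar_nonpos (hfeas n)).2
  exact ⟨hH, he, M.FOC_iff_marginalPayoff_eq_zero.2
      (deriv_eq_zero_of_isMaxOn_Icc (M.hasDerivWithinAt_payoff hH he) he hmax hzero hebar),
    ge_of_tendsto' (M.tendsto_integral_mul_φ hu hlim hs he hse) fun n => (hfeas n).2.2.2⟩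

theorem exists_solves (hfoa : M.FirstOrderApproach) (hfeas : ∃ H e, M.Feasible H e) :
    ∃ H e, M.Solves H e := by
  obtain ⟨H₀, e₀, h₀⟩ := hfeas
  obtain ⟨⟨H, e⟩, hHe, hmax⟩ := exists_isMaxOn_of_subseq_tendsto
    (K := {p : (ℝ → ℝ) × ℝ | M.Feasible p.1 p.2}) (J := fun p => M.payoff p.1 p.2)
    ⟨(H₀, e₀), h₀⟩ fun u hu => by
      obtain ⟨H, hH, ψ, hψ, hlim⟩ := exists_subseq_tendsto_of_mem_securities fun n => (hu n).1
      obtain ⟨e, he, χ, hχ, hse⟩ := isCompact_Icc.tendsto_subseq fun n => (hu (ψ n)).2.1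
      have hlimχ : ∀ᵐ x, x ∈ uIoc (0 : ℝ) 1 →
          Tendsto (fun n => (u (ψ (χ n))).1 x) atTop (𝓝 (H x)) := by
        filter_upwards [hlim] with x hx hx01 using (hx hx01).comp hχ.tendsto_atTop
      exact ⟨(H, e), hfoa.feasible_of_tendsto (fun n => hu (ψ (χ n))) hH hlimχ hse, ψ ∘ χ,
        hψ.comp hχ, M.tendsto_payoff (fun n => (hu (ψ (χ n))).1) hH hlimχ
          (fun n => (hu (ψ (χ n))).2.1) he hse⟩
  exact ⟨H, e, hHe, fun H' e' h' => hmax (a := (H', e')) h'⟩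

end FirstOrderApproach

theorem Solves.congr_of_integral_mul_eq (hsol : M.Solves H e) (hG : G ∈ securities)
    (hφ : ∫ x in (0 : ℝ)..1, G x * M.φ e x = ∫ x in (0 : ℝ)..1, H x * M.φ e x)
    (hφe : ∫ x in (0 : ℝ)..1, G x * M.φe e x = ∫ x in (0 : ℝ)..1, H x * M.φe e x) :
    M.Solves G e := by
  obtain ⟨⟨hH, he, hfoc, hinv⟩, hopt⟩ := hsol
  have hpayoff : M.payoff G e = M.payoff H e := by
    rw [M.payoff_eq hG he, M.payoff_eq hH he, hφ]
  have hmarginal : M.marginalPayoff G e = M.marginalPayoff H e := by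
    rw [M.marginalPayoff_eq hG he, M.marginalPayoff_eq hH he, hφe]
  rw [FOC_iff_marginalPayoff_eq_zero, ← hmarginal, ← FOC_iff_marginalPayoff_eq_zero] at hfoc
  exact ⟨⟨hG, he, hfoc, hinv.trans_eq hφ.symm⟩, fun H' e' h' =>
    (hopt H' e' h').trans_eq hpayoff.symm⟩

end MoralHazard

theorem proposition3 (M : MoralHazard)
    (hfoa : ∀ H ∈ securities, ∀ e ∈ Icc 0 M.ebar, M.FOC H e → M.SolvesEffort H e)
    (hfeas : ∃ H e, M.Feasible H e) :
    ∃ H e, IsContingentDebt H 2 ∧ M.Solves H e := by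
  obtain ⟨H, e, hsol⟩ := MoralHazard.FirstOrderApproach.exists_solves hfoa hfeas
  obtain ⟨hH, he, -⟩ := hsol.1
  obtain ⟨G, hG, hdebt, hmoments⟩ :=
    exists_isContingentDebt_moments_eq (w := ![M.φ e, M.φe e]) hH
      (Fin.forall_fin_two.2 ⟨M.intervalIntegrable_φ he, M.intervalIntegrable_φe he⟩)
  exact ⟨G, e, hdebt, hsol.congr_of_integral_mul_eq hG (congrFun hmoments 0) (congrFun hmoments 1)⟩
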